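/- Let $\mathbf{k}$ be a field and let $\mathfrak{g}=\mathrm{Spec}(H)$ be a finite group scheme over $\mathbf{k}$, i.e. $H$ is a finite-dimensional commutative Hopf algebra over $\mathbf{k}$, with comultiplication $\mu$ and counit $\pi$. A $\mathfrak{g}$-ring is a commutative $\mathbf{k}$-algebra $R$ with an action of $\mathfrak{g}$ on $\mathrm{Spec}(R)$, that is, with a $\mathbf{k}$-algebra map $\partial:R\to R\otimes_{\mathbf{k}}H$ such that $(\mathrm{id}\otimes\pi)\circ\partial=\mathrm{id}$ and $(\partial\otimes\mathrm{id})\circ\partial=(\mathrm{id}\otimes\mu)\circ\partial$; a $\mathfrak{g}$-field is a $\mathfrak{g}$-ring that is a field. A $\mathfrak{g}$-field extension $(K,\partial)\subseteq(L,\partial')$ is a $\mathbf{k}$-algebra embedding $K\to L$ of $\mathfrak{g}$-fields compatible with $\partial$ and $\partial'$. Choose a $\mathbf{k}$-basis $b_0,\dots,b_{e-1}$ of $H$ with $\pi(b_0)=1$ and $\pi(b_i)=0$ for $i>0$, and write $\partial(x)=\sum_i\partial_i(x)\otimes b_i$ (so $\partial_0=\mathrm{id}$). Let $L_{\mathfrak{g}}$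 be the language of rings with additional constants for the elements of $\mathbf{k}$ and unary function symbols for $\partial_1,\dots,\partial_{e-1}$; $\mathfrak{g}$-fields are regarded as $L_{\mathfrak{g}}$-structures. A $\mathfrak{g}$-field $K$ is existentially closed if every quantifier-free $L_{\mathfrak{g}}$-formula $\varphi(x_1,\dots,x_n)$ with parameters from $K$ that has a realisation in some $\mathfrak{g}$-field extension of $K$ has a realisation in $K$. A field $M$ is pseudo-algebraically closed (PAC) if every absolutely irreducible affine variety over $M$ has an $M$-rational point; here a variety $V\subseteq\mathbb{A}^n_M$ with ideal $I\subseteq M[X_1,\dots,X_n]$ is absolutely irreducible if $I\cdot M^{\mathrm{alg}}[X_1,\dots,X_n]$ is a prime ideal. Then: if $K$ is an existentially closed $\mathfrak{g}$-field, the (pure) field $K$ is PAC. -/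

import Mathlib

open scoped TensorProduct

universe u v w

/-- A (right) action of the finite group scheme `𝔤 = Spec H` on `Spec R`, where `H` is a
commutative Hopf algebra over `k` and `R` is a `k`-algebra, given by its coaction
`∂ : R → R ⊗ H`, a `k`-algebra map satisfying the counit and the coassociativity conditions.
A `𝔤`-ring is a `k`-algebra `R` with such a structure; a `𝔤`-field is a `𝔤`-ring
which is a field. -/
structure GroupSchemeAction (k : Type u) (H : Type v) (R : Type w) [Field k]
    [CommRing H] [HopfAlgebra k H] [CommRing R] [Algebra k R] where
  /-- the coaction `∂` -/
  coact : R →ₐ[k] R ⊗[k] H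
  /-- `(id ⊗ π) ∘ ∂ = id`, where `π` is the counit of `H` -/
  counit_coact : ((Algebra.TensorProduct.rid k k R).toAlgHom.comp
      (Algebra.TensorProduct.map (AlgHom.id k R) (Bialgebra.counitAlgHom k H))).comp coact
    = AlgHom.id k R
  /-- `(∂ ⊗ id) ∘ ∂ = (id ⊗ μ) ∘ ∂`, where `μ` is the comultiplication of `H` -/
  coassoc : ((Algebra.TensorProduct.assoc k k k R H H).toAlgHom.comp
      (Algebra.TensorProduct.map coact (AlgHom.id k H))).comp coact
    = (Algebra.TensorProduct.map (AlgHom.id k R) (Bialgebra.comulAlgHom k H)).comp coact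

namespace GroupSchemeAction

/-- The operation symbols that `L_𝔤` has besides those of the language of rings: a constant for
each element of `k`, and unary function symbols `∂₁, …, ∂ₘ`, where `m + 1 = dim H`
(the symbol `∂ᵢ₊₁` is indexed by `i : Fin m`). -/
inductive Symbols (k : Type u) (m : ℕ) : ℕ → Type u
  | const (c : k) : Symbols k m 0
  | op (i : Fin m) : Symbols k m 1

/-- The first-order language `L_𝔤` of `𝔤`-rings. -/
abbrev Lang (k : Type u) (m : ℕ) : FirstOrder.Language.{u, 0} :=
  FirstOrder.Language.ring.sum ⟨Symbols k m, fun _ => Empty⟩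

variable {k : Type u} {H : Type v} [Field k] [CommRing H] [HopfAlgebra k H]

section Ring

variable {R : Type w} [CommRing R] [Algebra k R]

/-- The coordinates `∂ᵢ : R → R` of the coaction in a `k`-basis `b` of `H`:
`∂ x = ∑ᵢ ∂ᵢ(x) ⊗ bᵢ`. -/
noncomputable def coord (D : GroupSchemeAction k H R) {m : ℕ}
    (b : Module.Basis (Fin (m + 1)) k H) (i : Fin (m + 1)) (x : R) : R :=
  (b.baseChange R).repr (D.coact x) i

/-- A `𝔤`-ring, as a structure for the language `L_𝔤`. -/
@[reducible] noncomputable def langStructure (D : GroupSchemeAction k H R) {m : ℕ}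
    (b : Module.Basis (Fin (m + 1)) k H) : (Lang k m).Structure R :=
  letI : FirstOrder.Language.ring.Structure R := (FirstOrder.Ring.compatibleRingOfRing R).toStructure
  letI : FirstOrder.Language.Structure ⟨Symbols k m, fun _ => Empty⟩ R :=
    { funMap := fun s x => match s with
        | .const c => algebraMap k R c
        | .op i => D.coord b i.succ (x 0)
      RelMap := fun r _ => r.elim }
  FirstOrder.Language.sumStructure FirstOrder.Language.ring ⟨Symbols k m, fun _ => Empty⟩ R

/-- The formula `φ(c, x)`, with parameters `c` from `A` interpreted in `R` by `f`, holds in the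
`𝔤`-ring `R` for the tuple `x = a`. -/
def Holds (D : GroupSchemeAction k H R) {m : ℕ} (b : Module.Basis (Fin (m + 1)) k H)
    {A : Type w} {n : ℕ} (φ : (Lang k m).Formula (A ⊕ Fin n)) (f : A → R) (a : Fin n → R) : Prop :=
  letI := D.langStructure b
  φ.Realize (Sum.elim f a)

end Ring

/-- A homomorphism `f : K → L` of `k`-algebras is a homomorphism of `𝔤`-rings if
`∂_L ∘ f = (f ⊗ id) ∘ ∂_K`. When `K` and `L` are fields, `f` is injective, so it makes `L` an
extension of the `𝔤`-field `K`. -/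
def IsHom {K L : Type*} [CommRing K] [Algebra k K] [CommRing L] [Algebra k L]
    (D : GroupSchemeAction k H K) (E : GroupSchemeAction k H L) (f : K →ₐ[k] L) : Prop :=
  E.coact.comp f = (Algebra.TensorProduct.map f (AlgHom.id k H)).comp D.coact

/-- The `𝔤`-field `(K, ∂)` is existentially closed: every quantifier-free `L_𝔤`-formula `φ(x)`
over `K` (with `x` a finite tuple of variables) which has a realisation in some `𝔤`-field
extension of `K` has a realisation in `K`. -/
def IsExistentiallyClosed {K : Type w} [Field K] [Algebra k K] (D : GroupSchemeAction k H K)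
    {m : ℕ} (b : Module.Basis (Fin (m + 1)) k H) : Prop :=
  ∀ (L : Type w) [Field L] [Algebra k L] (E : GroupSchemeAction k H L) (f : K →ₐ[k] L),
    D.IsHom E f →
    ∀ (n : ℕ) (φ : (Lang k m).Formula (K ⊕ Fin n)), φ.IsQF →
      (∃ a : Fin n → L, E.Holds b φ f a) → ∃ a : Fin n → K, D.Holds b φ id a

end GroupSchemeAction

/-- The affine variety over `M` with ideal `I` is absolutely irreducible (also: geometrically
integral): the ideal which `I` generates over the algebraic closure of `M` is prime. -/
def IsAbsolutelyIrreducible {M : Type*} [Field M] {n : ℕ}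
    (I : Ideal (MvPolynomial (Fin n) M)) : Prop :=
  (I.map (MvPolynomial.map (algebraMap M (AlgebraicClosure M)))).IsPrime

/-- A field `M` is pseudo-algebraically closed if each absolutely irreducible (affine) variety
over `M` has an `M`-rational point. -/
def IsPAC (M : Type*) [Field M] : Prop :=
  ∀ (n : ℕ) (I : Ideal (MvPolynomial (Fin n) M)), IsAbsolutelyIrreducible I →
    ∃ a : Fin n → M, ∀ p ∈ I, MvPolynomial.eval a p = 0

/-! Let `C` be the field of constants of `K`. As in Artin's lemma, elements of `K` independent over
`C` have coactions independent over `K` (`linearIndependent_coact`). These lie in `K ⊗ H`, which has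
finite dimension over `K`, so `K / C` is finite.

If `F / C` is a geometrically integral field extension on which `𝔤` acts trivially, then `K ⊗[C] F`
is a domain algebraic over `F`, hence a `𝔤`-field extending `K`. By existential closedness, it
suffices to find a point of the given variety `V` in such a `K ⊗[C] F`. In effect `F` comes from the
Weil restriction of `V` to `C`, built birationally in two steps through the separable closure `E` of
`C` in `K` (`IsGeomIntegral.exists_algHom_tensorProduct`).

Purely inseparable step, `K / E`: the function field `L` of `V` has a separating transcendence basis
`s` over `K`. If `M` is the separable closure of `E(s)` in `L`, then `L = K ⊗[E] M`, so the function
field descends to `E`.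

Separable step, `E / C`: with `N / C` finite Galois containing `E`, tensor over `N` the conjugates
of `M` along all `C`-embeddings `E → N`. The Galois group acts semilinearly on the fraction field
`P` of this domain, and `F` is its fixed field. The copy of `M` at the given embedding is fixed by
every automorphism trivial on `E`, so it lies in the compositum of `E` and `F`, which is `E ⊗[C] F`.
Base change to `K` gives `L → K ⊗[C] F`. -/

/-! ### Domains among tensor products; geometric integrality -/

section TensorDomain

/-- A nonzero element of a finitely generated algebra without zero divisors over an algebraically
closed field does not vanish at some rational point. -/
theorem exists_algHom_apply_ne_zero {k A : Type*} [Field k] [IsAlgClosed k] [CommRing A]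
    [IsDomain A] [Algebra k A] [Algebra.FiniteType k A] {a : A} (ha : a ≠ 0) :
    ∃ f : A →ₐ[k] k, f a ≠ 0 := by
  have hnil : ¬ IsNilpotent a := fun h => ha h.eq_zero
  have hj : IsJacobsonRing A := isJacobsonRing_of_finiteType (A := k) (B := A)
  -- In a Jacobson domain the maximal ideals intersect in zero, so one of them misses `a`; its
  -- residue field is finite over `k`, hence equal to `k`.
  have hr : (⊥ : Ideal A).jacobson = ⊥ :=
    (isJacobsonRing_iff_prime_eq.1 hj) ⊥ Ideal.isPrime_bot
  have hmem : a ∉ (⊥ : Ideal A).jacobson := by rw [hr]; simpa using ha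
  rw [Ideal.jacobson, Ideal.mem_sInf] at hmem
  push Not at hmem
  obtain ⟨I, ⟨-, hI⟩, haI⟩ := hmem
  let : Field (A ⧸ I) := Ideal.Quotient.field I
  have : Module.Finite k (A ⧸ I) := finite_of_finite_type_of_isJacobsonRing k (A ⧸ I)
  have hb : Function.Bijective (algebraMap k (A ⧸ I)) :=
    IsAlgClosed.algebraMap_bijective_of_isIntegral
  let e : k ≃ₐ[k] (A ⧸ I) := AlgEquiv.ofBijective (Algebra.ofId k (A ⧸ I)) hb
  refine ⟨(e.symm : (A ⧸ I) →ₐ[k] k).comp (Ideal.Quotient.mkₐ k I), fun h => haI ?_⟩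
  simpa [Ideal.Quotient.eq_zero_iff_mem] using h

/-- Over an algebraically closed field, the tensor product of two algebras without zero divisors
has no zero divisors. -/
theorem isDomain_tensorProduct_of_isAlgClosed {k A B : Type*} [Field k] [IsAlgClosed k]
    [CommRing A] [IsDomain A] [Algebra k A] [CommRing B] [IsDomain B] [Algebra k B] :
    IsDomain (A ⊗[k] B) := by
  let b := Module.Basis.ofVectorSpace k B
  have key : ∀ x y : A ⊗[k] B, x * y = 0 → x = 0 ∨ y = 0 := by
    intro x y hxy
    by_contra! hne
    obtain ⟨i, hi⟩ : ∃ i, (b.baseChange A).repr x i ≠ 0 := by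
      by_contra! h
      exact hne.1 ((b.baseChange A).repr.map_eq_zero_iff.1 (Finsupp.ext h))
    obtain ⟨j, hj⟩ : ∃ j, (b.baseChange A).repr y j ≠ 0 := by
      by_contra! h
      exact hne.2 ((b.baseChange A).repr.map_eq_zero_iff.1 (Finsupp.ext h))
    classical
    -- Only finitely many coefficients occur in `x` and `y`, so both lie over a finitely generated
    -- subalgebra, where the Nullstellensatz applies.
    let s : Finset A := ((b.baseChange A).repr x).support.image ((b.baseChange A).repr x) ∪
      ((b.baseChange A).repr y).support.image ((b.baseChange A).repr y)
    let A' := Algebra.adjoin k (s : Set A)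
    have : Algebra.FiniteType k A' :=
      (Subalgebra.fg_iff_finiteType _).1 (Subalgebra.fg_adjoin_finset s)
    have hx : ∀ l, (b.baseChange A).repr x l ∈ A' := by
      intro l
      by_cases h : (b.baseChange A).repr x l = 0
      · rw [h]; exact zero_mem _
      · exact Algebra.subset_adjoin (by
          simp only [s, Finset.coe_union, Finset.coe_image]
          exact Or.inl ⟨l, by simpa using h, rfl⟩)
    have hy : ∀ l, (b.baseChange A).repr y l ∈ A' := by
      intro l
      by_cases h : (b.baseChange A).repr y l = 0
      · rw [h]; exact zero_mem _
      · exact Algebra.subset_adjoin (by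
          simp only [s, Finset.coe_union, Finset.coe_image]
          exact Or.inr ⟨l, by simpa using h, rfl⟩)
    let m : A' ⊗[k] B →ₐ[k] A ⊗[k] B := Algebra.TensorProduct.map A'.val (AlgHom.id k B)
    have hm : Function.Injective m :=
      Module.Flat.rTensor_preserves_injective_linearMap A'.val.toLinearMap
        Subtype.val_injective
    have lift : ∀ z : A ⊗[k] B, (hz : ∀ l, (b.baseChange A).repr z l ∈ A') →
        ∃ z' : A' ⊗[k] B, m z' = z ∧
          ∀ l, ((b.baseChange A').repr z' l : A) = (b.baseChange A).repr z l := by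
      intro z hz
      refine ⟨(b.baseChange A').repr.symm
        (Finsupp.onFinset ((b.baseChange A).repr z).support
          (fun l => ⟨(b.baseChange A).repr z l, hz l⟩) (fun l hl => ?_)), ?_, fun l => ?_⟩
      · rw [Finsupp.mem_support_iff]
        exact fun h => hl (Subtype.ext h)
      · conv_rhs => rw [← (b.baseChange A).linearCombination_repr z]
        rw [Module.Basis.repr_symm_apply, Finsupp.linearCombination_onFinset,
          Finsupp.linearCombination_apply, Finsupp.sum, map_sum]
        refine Finset.sum_congr rfl fun l _ => ?_
        simp [m, TensorProduct.smul_tmul']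
      · simp
    obtain ⟨x', hx', hx''⟩ := lift x hx
    obtain ⟨y', hy', hy''⟩ := lift y hy
    have hxy' : x' * y' = 0 := hm (by rw [map_mul, hx', hy', hxy, map_zero])
    have hprod : (b.baseChange A').repr x' i * (b.baseChange A').repr y' j ≠ 0 := by
      refine mul_ne_zero (fun h => hi ?_) (fun h => hj ?_)
      · rw [← hx'', h]; rfl
      · rw [← hy'', h]; rfl
    -- Specialising at a rational point where both chosen coefficients survive gives two nonzero
    -- elements of the domain `B` with product zero.
    obtain ⟨f, hf⟩ := exists_algHom_apply_ne_zero (k := k) hprod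
    let g : A' ⊗[k] B →ₐ[k] B := Algebra.TensorProduct.lift
      ((Algebra.ofId k B).comp f) (AlgHom.id k B) (fun _ _ => Commute.all _ _)
    have hg : ∀ (z : A' ⊗[k] B) l, b.repr (g z) l = f ((b.baseChange A').repr z l) := by
      intro z l
      induction z using TensorProduct.induction_on with
      | zero => simp
      | tmul a c => 
        have : g (a ⊗ₜ c) = f a • c := by simp [g, Algebra.ofId_apply, Algebra.smul_def]
        simp [this, mul_comm]
      | add z z' h h' => simp [h, h']
    have := congrArg g hxy'
    rw [map_mul, map_zero, mul_eq_zero] at this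
    rw [map_mul] at hf
    rcases this with h | h
    · exact hf (mul_eq_zero_of_left (by rw [← hg, h]; simp) _)
    · exact hf (mul_eq_zero_of_right _ (by rw [← hg, h]; simp))
  have : Nontrivial (A ⊗[k] B) := by
    have := b.index_nonempty
    infer_instance
  have : NoZeroDivisors (A ⊗[k] B) := ⟨fun {x y} h => key x y h⟩
  exact NoZeroDivisors.to_isDomain _

/-- An algebra `A` over a field `k` is geometrically integral if `B ⊗ A` is a domain for each
`k`-algebra `B` which is a domain. -/
def IsGeomIntegral (k A : Type w) [Field k] [CommRing A] [Algebra k A] : Prop :=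
  ∀ (B : Type w) [CommRing B] [IsDomain B] [Algebra k B], IsDomain (B ⊗[k] A)

/-- Geometric integrality can be tested on one algebraically closed algebraic extension. -/
theorem IsGeomIntegral.of_isDomain {k A Ω : Type w} [Field k] [CommRing A] [Algebra k A] [Field Ω]
    [Algebra k Ω] [IsAlgClosed Ω] [Algebra.IsAlgebraic k Ω] (h : IsDomain (Ω ⊗[k] A)) :
    IsGeomIntegral k A := by
  intro B _ _ _
  -- `F` contains both `B` and a copy of `Ω`, so `B ⊗ A` embeds in `F ⊗[k] A = F ⊗[Ω] (Ω ⊗[k] A)`.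
  let F := AlgebraicClosure (FractionRing B)
  let : Algebra Ω F := (IsAlgClosed.lift : Ω →ₐ[k] F).toRingHom.toAlgebra
  have : IsScalarTower k Ω F := .of_algebraMap_eq fun x =>
    ((IsAlgClosed.lift : Ω →ₐ[k] F).commutes x).symm
  have h1 : IsDomain (F ⊗[Ω] (Ω ⊗[k] A)) := isDomain_tensorProduct_of_isAlgClosed
  have h2 : IsDomain (F ⊗[k] A) :=
    (Algebra.TensorProduct.cancelBaseChange k Ω Ω F A).symm.toMulEquiv.isDomain
  let j : B →ₐ[k] F := IsScalarTower.toAlgHom k B F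
  have hj : Function.Injective j := by
    change Function.Injective (algebraMap B F)
    rw [IsScalarTower.algebraMap_eq B (FractionRing B) F]
    exact (algebraMap (FractionRing B) F).injective.comp (IsFractionRing.injective B _)
  have hinj : Function.Injective (Algebra.TensorProduct.map j (AlgHom.id k A)) :=
    Module.Flat.rTensor_preserves_injective_linearMap j.toLinearMap hj
  exact hinj.isDomain (Algebra.TensorProduct.map j (AlgHom.id k A)).toRingHom

/-- The fraction field of a geometrically integral algebra is geometrically integral. -/
theorem IsGeomIntegral.fractionRing {k A L : Type w} [Field k] [CommRing A] [IsDomain A]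
    [Algebra k A] [Field L] [Algebra k L] [Algebra A L] [IsScalarTower k A L] [IsFractionRing A L]
    (h : IsGeomIntegral k A) : IsGeomIntegral k L := by
  intro B _ _ _
  have := h B
  have h1 : IsDomain (A ⊗[k] B) := (Algebra.TensorProduct.comm k A B).toMulEquiv.isDomain
  have hinj : Function.Injective (algebraMap A (A ⊗[k] B)) :=
    Algebra.TensorProduct.includeLeft_injective (S := A) (algebraMap k B).injective
  -- This ring is the localization of `A ⊗ B` at the nonzero elements of `A`.
  have h2 : IsDomain ((A ⊗[k] B) ⊗[A] L) := by
    refine IsLocalization.isDomain_of_le_nonZeroDivisors (R := A ⊗[k] B) ((A ⊗[k] B) ⊗[A] L)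
      (M := Algebra.algebraMapSubmonoid (A ⊗[k] B) (nonZeroDivisors A)) ?_
    rintro _ ⟨a, ha, rfl⟩
    rw [mem_nonZeroDivisors_iff_ne_zero]
    exact fun h0 => nonZeroDivisors.ne_zero ha (hinj (by rw [h0, map_zero]))
  exact (((Algebra.TensorProduct.comm k B L).toMulEquiv.trans
    (Algebra.TensorProduct.cancelBaseChange k A A L B).symm.toMulEquiv).trans
      (Algebra.TensorProduct.comm A L (A ⊗[k] B)).toMulEquiv).isDomain

end TensorDomain

/-! ### Descent of regular function fields along purely inseparable extensions -/

section Descent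

open IntermediateField

/-- In a field extension `L / K` of characteristic `p` such that `K̄ ⊗ L` is reduced, the `p`-th
power map preserves linear independence. -/
theorem LinearIndependent.pow_expChar_of_isReduced {K L : Type*} [Field K] [Field L] [Algebra K L]
    (p : ℕ) [ExpChar K p] [IsReduced (AlgebraicClosure K ⊗[K] L)] {ι : Type*} {v : ι → L}
    (hv : LinearIndependent K v) : LinearIndependent K fun i => v i ^ p := by
  have : ExpChar (AlgebraicClosure K ⊗[K] L) p := expChar_of_injective_algebraMap
    (algebraMap K (AlgebraicClosure K ⊗[K] L)).injective p
  have hv' : LinearIndependent (AlgebraicClosure K)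
      fun i => (1 : AlgebraicClosure K) ⊗ₜ[K] v i := Module.Flat.linearIndependent_one_tmul hv
  rw [linearIndependent_iff'] at hv' ⊢
  intro s g hg i hi
  -- With `p`-th roots of the coefficients, the relation becomes the `p`-th power of a combination
  -- of the `1 ⊗ v i`, which vanishes by reducedness.
  choose d hd using fun i => IsAlgClosed.exists_pow_nat_eq
    (algebraMap K (AlgebraicClosure K) (g i)) (expChar_pos K p)
  have hsum : ∑ i ∈ s, d i • ((1 : AlgebraicClosure K) ⊗ₜ[K] v i) = 0 := by
    refine eq_zero_of_pow_eq_zero (n := p) ?_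
    rw [sum_pow_char]
    have : ∀ i ∈ s, (d i • ((1 : AlgebraicClosure K) ⊗ₜ[K] v i)) ^ p =
        (1 : AlgebraicClosure K) ⊗ₜ[K] (g i • v i ^ p) := by
      intro i _
      rw [TensorProduct.smul_tmul', smul_eq_mul, mul_one, Algebra.TensorProduct.tmul_pow, hd,
        Algebra.algebraMap_eq_smul_one, TensorProduct.smul_tmul]
    rw [Finset.sum_congr rfl this, ← TensorProduct.tmul_sum, hg, TensorProduct.tmul_zero]
  have := hv' s d hsum i hi
  have h := hd i
  rw [this, zero_pow (expChar_pos K p).ne'] at h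
  exact (algebraMap K (AlgebraicClosure K)).injective (by rw [← h, map_zero])

/-- A finitely generated geometrically integral field extension is separably generated. -/
theorem IsGeomIntegral.exists_separating_transcendenceBasis {K L : Type w} [Field K] [Field L]
    [Algebra K L] [Algebra.EssFiniteType K L] (h : IsGeomIntegral K L) :
    ∃ s : Finset L, IsTranscendenceBasis K ((↑) : s → L) ∧
      Algebra.IsSeparable (adjoin K (s : Set L)) L := by
  obtain ⟨p, hp⟩ := ExpChar.exists K
  cases hp with
  | zero => exact exists_isTranscendenceBasis_and_isSeparable_of_perfectField K L
  | prime hp =>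
    have : ExpChar K p := .prime hp
    have := h (AlgebraicClosure K)
    -- MacLane's criterion.
    exact exists_isTranscendenceBasis_and_isSeparable_of_linearIndepOn_pow_of_essFiniteType p hp
      fun s hs => LinearIndependent.pow_expChar_of_isReduced p hs

/-- Elements of `K` which are linearly independent over `E` remain so over `E(s)`, where `s` is
algebraically independent over `K`. -/
theorem AlgebraicIndependent.linearIndependent_adjoin {E K L ι : Type*} [Field E] [Field K]
    [Field L] [Algebra E K] [Algebra K L] [Algebra E L] [IsScalarTower E K L] {s : Set L}
    (hs : AlgebraicIndependent K ((↑) : s → L)) {v : ι → K} (hv : LinearIndependent E v) :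
    LinearIndependent (adjoin E s) fun i => algebraMap K L (v i) := by
  open scoped algebraAdjoinAdjoin in
  -- After clearing denominators the coefficients are polynomials in `s` over `E`; algebraic
  -- independence over `K` allows comparing coefficients monomial by monomial.
  rw [← LinearIndependent.iff_fractionRing (Algebra.adjoin E s), linearIndependent_iff']
  intro t g hg
  have hmem : ∀ i, ∃ q : MvPolynomial s E, MvPolynomial.aeval ((↑) : s → L) q = (g i : L) := by
    intro i
    have h : ∀ x ∈ Algebra.adjoin E s,
        ∃ q : MvPolynomial s E, MvPolynomial.aeval ((↑) : s → L) q = x := by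
      intro x hx
      rwa [Algebra.adjoin_eq_range] at hx
    exact h _ (g i).2
  choose q hq using hmem
  have hz : ∑ i ∈ t, v i • MvPolynomial.map (algebraMap E K) (q i) = 0 := by
    rw [algebraicIndependent_iff_injective_aeval] at hs
    apply hs
    rw [map_sum, map_zero, ← hg]
    refine Finset.sum_congr rfl fun i _ => ?_
    rw [map_smul, MvPolynomial.aeval_map_algebraMap, hq, Algebra.smul_def, Algebra.smul_def,
      mul_comm]
    rfl
  intro i hi
  rw [linearIndependent_iff'] at hv
  have : q i = 0 := by
    ext m
    refine hv t (fun j => (q j).coeff m) ?_ i hi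
    have := congrArg (MvPolynomial.coeff m) hz
    simp only [MvPolynomial.coeff_sum, MvPolynomial.coeff_smul, MvPolynomial.coeff_map,
      MvPolynomial.coeff_zero, smul_eq_mul] at this
    rw [← this]
    exact Finset.sum_congr rfl fun j _ => by rw [Algebra.smul_def, mul_comm]
  exact Subtype.ext (by rw [← hq, this, map_zero]; rfl)

/-- If `K / E` is algebraic and `K ⊗ M` is a domain, where `M` is a field, then `K ⊗ M` embeds into
each field which contains `K` and `M`. -/
theorem injective_tensorProductLift_of_isDomain {E K L M : Type*} [Field E] [Field K]
    [CommRing L] [Nontrivial L] [Field M] [Algebra E K] [Algebra K L] [Algebra E L]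
    [IsScalarTower E K L] [Algebra E M] [Algebra.IsAlgebraic E K] (f : M →ₐ[E] L)
    (hdom : IsDomain (K ⊗[E] M)) : Function.Injective
      (Algebra.TensorProduct.lift (Algebra.ofId K L) f (fun _ _ => Commute.all _ _)) := by
  have hfield : IsField (K ⊗[E] M) := Algebra.TensorProduct.isField_of_isAlgebraic E K M
    (.inl inferInstance)
  let := hfield.toField
  exact (Algebra.TensorProduct.lift (Algebra.ofId K L) f
    (fun _ _ => Commute.all _ _)).toRingHom.injective

/-- If `K / E` is algebraic and `K ⊗ M` is a domain, where `M` is a field, then the compositum of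
`K` and `M` in a field is the image of `K ⊗ M`. -/
theorem mem_range_tensorProductLift_of_mem_adjoin {E K L M : Type*} [Field E] [Field K]
    [Field L] [Field M] [Algebra E K] [Algebra K L] [Algebra E L] [IsScalarTower E K L]
    [Algebra E M] [Algebra.IsAlgebraic E K] (f : M →ₐ[E] L) (hdom : IsDomain (K ⊗[E] M))
    {x : L} (hx : x ∈ adjoin K (Set.range f)) :
    x ∈ (Algebra.TensorProduct.lift (Algebra.ofId K L) f (fun _ _ => Commute.all _ _)).range := by
  have hfield : IsField (K ⊗[E] M) := Algebra.TensorProduct.isField_of_isAlgebraic E K M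
    (.inl inferInstance)
  let φ : K ⊗[E] M →ₐ[K] L :=
    Algebra.TensorProduct.lift (Algebra.ofId K L) f (fun _ _ => Commute.all _ _)
  -- The image of the field `K ⊗ M` is closed under inverses, so it contains the compositum.
  let R : IntermediateField K L :=
    { φ.range with
      inv_mem' := by
        rintro _ ⟨y, rfl⟩
        by_cases hy : y = 0
        · subst hy
          exact ⟨0, by simp⟩
        · obtain ⟨z, hz⟩ := hfield.mul_inv_cancel hy
          exact ⟨z, eq_inv_of_mul_eq_one_right (by
            change φ y * φ z = 1
            rw [← map_mul, hz, map_one])⟩ }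
  have hR : adjoin K (Set.range f) ≤ R := by
    refine adjoin_le_iff.2 ?_
    rintro _ ⟨x, rfl⟩
    exact ⟨1 ⊗ₜ x, by simp [φ]⟩
  exact hR hx

/-- A separable extension of `K₁ = K · M₀` descends to a separable extension of `M₀` if `K₁ / M₀` is
purely inseparable and linearly independent elements of `K / E` stay independent over `M₀`. -/
theorem exists_descent_of_isPurelyInseparable {E K L M₀ K₁ : Type w} [Field E] [Field K] [Field L]
    [Field M₀] [Field K₁] [Algebra E K] [Algebra K L] [Algebra E L] [IsScalarTower E K L]
    [Algebra.IsAlgebraic E K] [Algebra E M₀] [Algebra M₀ L] [IsScalarTower E M₀ L] [Algebra K K₁]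
    [Algebra K₁ L] [IsScalarTower K K₁ L] [Algebra M₀ K₁] [IsScalarTower M₀ K₁ L]
    [IsPurelyInseparable M₀ K₁] [Algebra.IsSeparable K₁ L] {ι : Type*} (b : Module.Basis ι E K)
    (hb : LinearIndependent M₀ (algebraMap K K₁ ∘ b))
    (hK₁ : ∀ x, algebraMap K₁ L x ∈ adjoin K (Set.range (algebraMap M₀ L))) :
    ∃ (M : Type w) (_ : Field M) (_ : Algebra E M), Nonempty ((K ⊗[E] M) ≃ₐ[K] L) := by
  -- The separable closure of `M₀` in `L` is the descended field: it is linearly disjoint from the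
  -- purely inseparable `K₁` and generates `L` over it.
  have hS : (separableClosure M₀ L).LinearDisjoint K₁ :=
    linearDisjoint_of_isPurelyInseparable_of_isSeparable K₁ _
  have htop : adjoin K₁ (separableClosure M₀ L : Set L) = ⊤ :=
    separableClosure.adjoin_eq_of_isAlgebraic_of_isSeparable L
  have h₂ : LinearIndependent (separableClosure M₀ L) (algebraMap K L ∘ b) := by
    rw [IsScalarTower.algebraMap_eq K K₁ L]
    exact hS.linearIndependent_right' hb
  let M : IntermediateField E L := (separableClosure M₀ L).restrictScalars E
  have hM : M.LinearDisjoint K := .of_basis_right' b h₂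
  have hdom : IsDomain (K ⊗[E] M) :=
    have := hM.isDomain
    (Algebra.TensorProduct.comm E K M).toMulEquiv.isDomain
  have hgen : adjoin K (Set.range M.val) = ⊤ := by
    have hrange : Set.range M.val = (separableClosure M₀ L : Set L) := Subtype.range_coe
    rw [hrange]
    have hsub : (separableClosure M₀ L : Set L) ⊆ adjoin K (separableClosure M₀ L : Set L) :=
      subset_adjoin K _
    have hle : adjoin K (Set.range (algebraMap M₀ L)) ≤
        adjoin K (separableClosure M₀ L : Set L) := by
      refine adjoin_le_iff.2 ?_
      rintro _ ⟨x, rfl⟩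
      exact hsub (IntermediateField.algebraMap_mem _ x)
    rw [eq_top_iff]
    intro x _
    have hx : x ∈ adjoin K₁ (separableClosure M₀ L : Set L) := by rw [htop]; exact mem_top
    induction hx using adjoin_induction with
    | mem x hx => exact hsub hx
    | algebraMap x => exact hle (hK₁ x)
    | add x y _ _ hx hy => exact add_mem (hx trivial) (hy trivial)
    | inv x _ hx => exact inv_mem (hx trivial)
    | mul x y _ _ hx hy => exact mul_mem (hx trivial) (hy trivial)
  exact ⟨M, inferInstance, inferInstance, ⟨.ofBijective _
    ⟨injective_tensorProductLift_of_isDomain M.val hdom, fun x =>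
      mem_range_tensorProductLift_of_mem_adjoin M.val hdom (by rw [hgen]; exact mem_top)⟩⟩⟩

/-- A finitely generated geometrically integral field extension of `K` descends along a purely
inseparable extension `K / E`. -/
theorem IsGeomIntegral.exists_descent {E K L : Type w} [Field E] [Field K] [Field L] [Algebra E K]
    [Algebra K L] [Algebra E L] [IsScalarTower E K L] [IsPurelyInseparable E K]
    [Algebra.EssFiniteType K L] (h : IsGeomIntegral K L) :
    ∃ (M : Type w) (_ : Field M) (_ : Algebra E M), Nonempty ((K ⊗[E] M) ≃ₐ[K] L) := by
  obtain ⟨s, hs, hsep⟩ := h.exists_separating_transcendenceBasis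
  obtain ⟨q, _⟩ := ExpChar.exists E
  let M₀ := adjoin E (s : Set L)
  let K₁ := adjoin K (s : Set L)
  have hle : M₀ ≤ K₁.restrictScalars E := adjoin_le_iff.2 (subset_adjoin K _)
  let i : M₀ →+* K₁ := Subsemiring.inclusion hle
  let : Algebra M₀ K₁ := i.toAlgebra
  have : IsScalarTower M₀ K₁ L := IsScalarTower.of_algebraMap_eq (congrFun rfl)
  have : ExpChar M₀ q := expChar_of_injective_algebraMap (algebraMap E M₀).injective q
  have : ExpChar L q := expChar_of_injective_algebraMap (algebraMap E L).injective q
  -- The perfect closure of `E(s)` in `L` is a field containing `s` and `K`, hence `K(s)`.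
  have hpi : ∀ x ∈ K₁, x ∈ perfectClosure M₀ L := by
    intro x hx
    induction hx using adjoin_induction with
    | mem x hx => exact IntermediateField.algebraMap_mem _ (⟨x, subset_adjoin E _ hx⟩ : M₀)
    | algebraMap x =>
      rw [mem_perfectClosure_iff_pow_mem q]
      obtain ⟨n, y, hy⟩ := IsPurelyInseparable.pow_mem E q x
      refine ⟨n, algebraMap E M₀ y, ?_⟩
      rw [← map_pow, ← hy, ← IsScalarTower.algebraMap_apply, ← IsScalarTower.algebraMap_apply]
    | add x y _ _ hx hy => exact add_mem hx hy
    | inv x _ hx => exact inv_mem hx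
    | mul x y _ _ hx hy => exact mul_mem hx hy
  have : IsPurelyInseparable M₀ K₁ := by
    rw [isPurelyInseparable_iff_pow_mem M₀ q]
    intro x
    obtain ⟨n, y, hy⟩ := (mem_perfectClosure_iff_pow_mem q).1 (hpi x x.2)
    exact ⟨n, y, Subtype.ext hy⟩
  refine exists_descent_of_isPurelyInseparable (M₀ := M₀) (K₁ := K₁)
    (Module.Basis.ofVectorSpace E K) ?_ ?_
  · exact LinearIndependent.of_comp (IsScalarTower.toAlgHom M₀ K₁ L).toLinearMap
      (hs.1.linearIndependent_adjoin (Module.Basis.ofVectorSpace E K).linearIndependent)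
  · have hle' : K₁ ≤ adjoin K (Set.range (algebraMap M₀ L)) := adjoin_le_iff.2 fun x hx =>
      subset_adjoin K _ ⟨⟨x, subset_adjoin E _ hx⟩, rfl⟩
    exact fun x => hle' x.2

/-- A `K`-form over `E` of a geometrically integral algebra is geometrically integral. -/
theorem IsGeomIntegral.of_bijective {E K L M : Type w} [Field E] [Field K] [CommRing L]
    [CommRing M] [Algebra E K] [Algebra.IsAlgebraic E K] [Algebra K L] [Algebra E M]
    (h : IsGeomIntegral K L) (e : (K ⊗[E] M) ≃ₐ[K] L) : IsGeomIntegral E M := by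
  have : Algebra.IsAlgebraic E (AlgebraicClosure K) :=
    Algebra.IsAlgebraic.trans E K (AlgebraicClosure K)
  have := h (AlgebraicClosure K)
  refine .of_isDomain (Ω := AlgebraicClosure K) ?_
  let e' : AlgebraicClosure K ⊗[K] (K ⊗[E] M) ≃ₐ[K] AlgebraicClosure K ⊗[K] L :=
    Algebra.TensorProduct.congr AlgEquiv.refl e
  exact ((Algebra.TensorProduct.cancelBaseChange E K K
    (AlgebraicClosure K) M).symm.toMulEquiv.trans e'.toMulEquiv).isDomain

end Descent

/-! ### Tensor product of the conjugates of an algebra -/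

section WeilRestriction

open IntermediateField

/-- The tensor product over `N` of the base changes of a geometrically integral `E`-algebra `M`
along finitely many embeddings `σ i : E → N`. -/
theorem IsGeomIntegral.exists_tensorProduct_baseChange {E N M : Type w} [Field E] [Field N]
    [CommRing M] [Algebra E M] (hM : IsGeomIntegral E M) (n : ℕ) (σ : Fin n → E →+* N) :
    ∃ (Q : Type w) (_ : CommRing Q) (_ : Algebra N Q) (ι : Fin n → M →+* Q),
      (∀ i, (ι i).comp (algebraMap E M) = (algebraMap N Q).comp (σ i)) ∧
      (∀ (S : Type w) [CommRing S] (φ : N →+* S) (j : Fin n → M →+* S),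
        (∀ i, (j i).comp (algebraMap E M) = φ.comp (σ i)) →
        ∃ h : Q →+* S, h.comp (algebraMap N Q) = φ ∧ ∀ i, h.comp (ι i) = j i) ∧
      (∀ (S : Type w) [CommRing S] (h h' : Q →+* S),
        h.comp (algebraMap N Q) = h'.comp (algebraMap N Q) →
        (∀ i, h.comp (ι i) = h'.comp (ι i)) → h = h') ∧
      IsGeomIntegral N Q := by
  induction n with
  | zero =>
    refine ⟨N, inferInstance, inferInstance, Fin.elim0, fun i => i.elim0,
      fun S _ φ j _ => ⟨φ, RingHom.ext fun _ => rfl, fun i => i.elim0⟩,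
      fun S _ h h' hh _ => RingHom.ext fun x => congrArg (fun f : N →+* S => f x) hh, ?_⟩
    intro B _ _ _
    exact (Algebra.TensorProduct.rid N N B).toMulEquiv.isDomain
  | succ n ih =>
    obtain ⟨Q, _, _, ι, hι, hlift, hext, hQ⟩ := ih fun i => σ i.succ
    -- Each embedding makes `N` a different `E`-algebra; here `E` acts through `σ 0`, and `Q ⊗[E] M`
    -- adjoins the conjugate with index `0`. The universal property is stated for ring homomorphisms
    -- so that semilinear maps are covered.
    let : Algebra E N := (σ 0).toAlgebra
    let : Algebra E Q := ((algebraMap N Q).comp (σ 0)).toAlgebra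
    have : IsScalarTower E N Q := .of_algebraMap_eq fun _ => rfl
    let iQ : Q →ₐ[N] Q ⊗[E] M := Algebra.TensorProduct.includeLeft
    let iM : M →ₐ[E] Q ⊗[E] M := Algebra.TensorProduct.includeRight
    refine ⟨Q ⊗[E] M, inferInstance, inferInstance,
      Fin.cons iM.toRingHom fun i => iQ.toRingHom.comp (ι i), ?_, ?_, ?_, ?_⟩
    · intro i
      refine Fin.cases ?_ (fun i => ?_) i
      · refine RingHom.ext fun x => ?_
        exact iM.commutes x
      · refine RingHom.ext fun x => ?_
        have := congrArg (fun f : E →+* Q => iQ (f x)) (hι i)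
        simpa using this
    · intro S _ φ j hj
      obtain ⟨h, hN, hM'⟩ := hlift S φ (fun i => j i.succ) fun i => hj i.succ
      let : Algebra E S := (φ.comp (σ 0)).toAlgebra
      have hc : ∀ x, h (algebraMap E Q x) = algebraMap E S x := fun x => by
        change h (algebraMap N Q (σ 0 x)) = φ (σ 0 x)
        rw [← hN]
        rfl
      have hc' : ∀ x, j 0 (algebraMap E M x) = algebraMap E S x := fun x =>
        congrArg (fun f : E →+* S => f x) (hj 0)
      let h₁ : Q →ₐ[E] S := { h with commutes' := hc }
      let h₂ : M →ₐ[E] S := { j 0 with commutes' := hc' }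
      refine ⟨(Algebra.TensorProduct.productMap h₁ h₂).toRingHom, RingHom.ext fun x => ?_,
        fun i => ?_⟩
      · rw [← hN]
        change Algebra.TensorProduct.productMap h₁ h₂ (algebraMap N Q x ⊗ₜ 1) = _
        simp [h₁]
      · refine Fin.cases ?_ (fun i => ?_) i
        · refine RingHom.ext fun x => ?_
          change Algebra.TensorProduct.productMap h₁ h₂ (1 ⊗ₜ x) = _
          simp [h₂]
        · refine RingHom.ext fun x => ?_
          rw [← hM']
          change Algebra.TensorProduct.productMap h₁ h₂ (ι i x ⊗ₜ 1) = _
          simp [h₁]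
    · intro S _ h h' hN hM'
      have hQ' : h.comp iQ.toRingHom = h'.comp iQ.toRingHom := by
        refine hext S _ _ ?_ fun i => ?_
        · refine RingHom.ext fun x => ?_
          have := congrArg (fun f : N →+* S => f x) hN
          exact this
        · exact hM' i.succ
      refine RingHom.ext fun z => ?_
      induction z using TensorProduct.induction_on with
      | zero => simp
      | add x y hx hy => rw [map_add, map_add, hx, hy]
      | tmul x y =>
        have h1 := congrArg (fun f : Q →+* S => f x) hQ'
        have h2 := congrArg (fun f : M →+* S => f y) (hM' 0)
        have : x ⊗ₜ[E] y = iQ x * iM y := by simp [iQ, iM]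
        rw [this, map_mul, map_mul]
        exact congrArg₂ (· * ·) h1 h2
    · intro B _ _ _
      let : Algebra E B := ((algebraMap N B).comp (σ 0)).toAlgebra
      have : IsScalarTower E N B := .of_algebraMap_eq fun _ => rfl
      have := hQ B
      have := hM (B ⊗[N] Q)
      exact (Algebra.TensorProduct.assoc E N N B Q M).symm.toMulEquiv.isDomain

end WeilRestriction

/-! ### Semilinear Galois actions and their fixed fields -/

section GaloisDescent

open IntermediateField

/-- Let the Galois group of `N / C` act on a field `P ⊇ N` compatibly with its action on `N`. Then a
`C`-basis of `N` is linearly independent over the fixed field of `P`. -/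
theorem linearIndependent_fixedPoints_of_basis {C N P ι : Type*} [Field C] [Field N] [Field P]
    [Algebra C N] [Algebra N P] [Algebra C P] [IsScalarTower C N P] [FiniteDimensional C N]
    [IsGalois C N] [Finite ι]
    [MulSemiringAction (N ≃ₐ[C] N) P] [SMulCommClass (N ≃ₐ[C] N) C P]
    (hact : ∀ (γ : N ≃ₐ[C] N) n, γ • algebraMap N P n = algebraMap N P (γ n))
    (b : Module.Basis ι C N) :
    LinearIndependent (FixedPoints.intermediateField (N ≃ₐ[C] N) : IntermediateField C P)
      (algebraMap N P ∘ b) := by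
  classical
  have := Fintype.ofFinite ι
  rw [Fintype.linearIndependent_iff]
  intro f hf j
  -- Multiplying a relation by the trace-dual element `b' j` and summing over the group isolates the
  -- coefficient `f j`.
  let b' := (Algebra.traceForm C N).dualBasis (traceForm_nondegenerate C N) b
  have hsum : ∑ γ : N ≃ₐ[C] N, γ • (algebraMap N P (b' j) *
      ∑ i, f i • (algebraMap N P ∘ b) i) = (f j : P) := by
    calc _ = ∑ γ : N ≃ₐ[C] N, ∑ i, (f i : P) * algebraMap N P (γ (b' j * b i)) := by
          refine Finset.sum_congr rfl fun γ _ => ?_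
          rw [Finset.mul_sum, Finset.smul_sum]
          refine Finset.sum_congr rfl fun i _ => ?_
          have h1 : γ • (f i : P) = f i := (f i).2 γ
          have h2 : f i • (algebraMap N P ∘ b) i = (f i : P) * algebraMap N P (b i) := rfl
          rw [h2, smul_mul', smul_mul', h1, hact, hact, map_mul, map_mul]
          ring
      _ = ∑ i, (f i : P) * algebraMap C P (Algebra.trace C N (b' j * b i)) := by
          rw [Finset.sum_comm]
          refine Finset.sum_congr rfl fun i _ => ?_
          rw [← Finset.mul_sum, IsScalarTower.algebraMap_apply C N P,
            trace_eq_sum_automorphisms, map_sum]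
      _ = (f j : P) := by
          have h : ∀ i, Algebra.trace C N (b' j * b i) = if i = j then 1 else 0 := fun i =>
            LinearMap.BilinForm.apply_dualBasis_left (B := Algebra.traceForm C N)
              (traceForm_nondegenerate C N) b j i
          simp [h]
  rw [hf] at hsum
  exact Subtype.ext (by rw [← hsum]; simp)

/-- Let the Galois group of `N / C` act on a field `P ⊇ N` compatibly with its action on `N`. Then
the tensor product of `N` with the fixed field of `P` embeds into `P`. -/
theorem injective_tensorProductLift_fixedPoints {C N P : Type*} [Field C] [Field N] [Field P]
    [Algebra C N] [Algebra N P] [Algebra C P] [IsScalarTower C N P] [FiniteDimensional C N]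
    [IsGalois C N] [MulSemiringAction (N ≃ₐ[C] N) P] [SMulCommClass (N ≃ₐ[C] N) C P]
    (hact : ∀ (γ : N ≃ₐ[C] N) n, γ • algebraMap N P n = algebraMap N P (γ n)) :
    Function.Injective (Algebra.TensorProduct.lift (Algebra.ofId N P)
      (FixedPoints.intermediateField (N ≃ₐ[C] N) : IntermediateField C P).val
      (fun _ _ => Commute.all _ _)) := by
  let F : IntermediateField C P := FixedPoints.intermediateField (N ≃ₐ[C] N)
  let b := Module.finBasis C N
  have hli := linearIndependent_fixedPoints_of_basis hact b
  have hF : F.LinearDisjoint N := .of_basis_right' b hli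
  have hdom : IsDomain (N ⊗[C] F) :=
    have := hF.isDomain
    (Algebra.TensorProduct.comm C N F).toMulEquiv.isDomain
  exact injective_tensorProductLift_of_isDomain F.val hdom

/-- If `N / C` is algebraic and `N ⊗ A` embeds into a geometrically integral `N`-algebra, then `A` is
geometrically integral over `C`. -/
theorem IsGeomIntegral.of_injective_baseChange {C N A P : Type w} [Field C] [Field N] [CommRing A]
    [CommRing P] [Algebra C N] [Algebra.IsAlgebraic C N] [Algebra C A] [Algebra N P]
    (hP : IsGeomIntegral N P) (φ : N ⊗[C] A →ₐ[N] P) (hφ : Function.Injective φ) :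
    IsGeomIntegral C A := by
  have : Algebra.IsAlgebraic C (AlgebraicClosure N) :=
    Algebra.IsAlgebraic.trans C N (AlgebraicClosure N)
  have := hP (AlgebraicClosure N)
  let ψ : AlgebraicClosure N ⊗[N] (N ⊗[C] A) →ₐ[N] AlgebraicClosure N ⊗[N] P :=
    Algebra.TensorProduct.map (AlgHom.id N _) φ
  have hψ : Function.Injective ψ :=
    Module.Flat.lTensor_preserves_injective_linearMap φ.toLinearMap hφ
  have : IsDomain (AlgebraicClosure N ⊗[N] (N ⊗[C] A)) := hψ.isDomain ψ.toRingHom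
  exact .of_isDomain (Ω := AlgebraicClosure N)
    (Algebra.TensorProduct.cancelBaseChange C N N (AlgebraicClosure N) A).symm.toMulEquiv.isDomain

/-- Let the Galois group of `N / C` act on a geometrically integral field extension `P / N`
compatibly with its action on `N`. Then the fixed field of `P` is geometrically integral
over `C`. -/
theorem IsGeomIntegral.fixedPoints {C N P : Type w} [Field C] [Field N] [Field P]
    [Algebra C N] [Algebra N P] [Algebra C P] [IsScalarTower C N P] [FiniteDimensional C N]
    [IsGalois C N] [MulSemiringAction (N ≃ₐ[C] N) P] [SMulCommClass (N ≃ₐ[C] N) C P]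
    (hact : ∀ (γ : N ≃ₐ[C] N) n, γ • algebraMap N P n = algebraMap N P (γ n))
    (hP : IsGeomIntegral N P) :
    IsGeomIntegral C (FixedPoints.intermediateField (N ≃ₐ[C] N) : IntermediateField C P) :=
  hP.of_injective_baseChange _ (injective_tensorProductLift_fixedPoints hact)

/-- Let the Galois group of `N / C` act on a field `P ⊇ N` compatibly with its action on `N`, and let
`E` be a subfield of `N / C`. An element of `P` which is fixed by each automorphism that fixes `E`
belongs to the compositum of `E` and the fixed field of `P`. -/
theorem mem_adjoin_fixedPoints {C E N P : Type*} [Field C] [Field E] [Field N] [Field P]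
    [Algebra C E] [Algebra C N] [Algebra E N] [IsScalarTower C E N]
    [Algebra N P] [Algebra C P] [IsScalarTower C N P] [Algebra E P] [IsScalarTower E N P]
    [FiniteDimensional C N] [MulSemiringAction (N ≃ₐ[C] N) P] [SMulCommClass (N ≃ₐ[C] N) C P]
    (hact : ∀ (γ : N ≃ₐ[C] N) n, γ • algebraMap N P n = algebraMap N P (γ n)) {x : P}
    (hx : ∀ γ : N ≃ₐ[C] N, (∀ e, γ (algebraMap E N e) = algebraMap E N e) → γ • x = x) :
    x ∈ adjoin E (Set.range
      (FixedPoints.intermediateField (N ≃ₐ[C] N) : IntermediateField C P).val) := by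
  -- By Artin, `P` is Galois over its fixed field and every automorphism comes from the group, so
  -- the Galois correspondence puts `x` in the field generated by `E` over `F'`.
  let F' := FixedPoints.subfield (N ≃ₐ[C] N) P
  let Y : IntermediateField F' P := adjoin F' (Set.range (algebraMap E P))
  have hY : x ∈ Y := by
    rw [← IsGalois.fixedField_fixingSubgroup Y]
    rintro ⟨φ, hφ⟩
    obtain ⟨γ, rfl⟩ := FixedPoints.toAlgAut_surjective (N ≃ₐ[C] N) P φ
    refine hx γ fun e => (algebraMap N P).injective ?_
    rw [← hact, ← IsScalarTower.algebraMap_apply]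
    exact (IntermediateField.mem_fixingSubgroup_iff Y _).1 hφ _
      (subset_adjoin F' _ ⟨e, rfl⟩)
  clear hx
  induction hY using adjoin_induction with
  | mem x hx =>
    obtain ⟨e, rfl⟩ := hx
    exact IntermediateField.algebraMap_mem _ e
  | algebraMap x => exact subset_adjoin E _ ⟨⟨x, x.2⟩, rfl⟩
  | add x y _ _ hx hy => exact add_mem hx hy
  | inv x _ hx => exact inv_mem hx
  | mul x y _ _ hx hy => exact mul_mem hx hy

end GaloisDescent

/-! ### Points in `K ⊗ F` for finite extensions `K / C` -/

section FiniteDescent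

open IntermediateField

/-- A geometrically integral algebra over a field is a domain. -/
theorem IsGeomIntegral.isDomain {k A : Type w} [Field k] [CommRing A] [Algebra k A]
    (h : IsGeomIntegral k A) : IsDomain A :=
  have := h k
  (Algebra.TensorProduct.lid k A).symm.toMulEquiv.isDomain

/-- A geometrically integral algebra `M` over a finite subextension `E` of a finite Galois extension
`N / C` has a point in `E ⊗ F` for some geometrically integral field extension `F / C`. -/
theorem IsGeomIntegral.exists_algHom_tensorProduct_of_isGalois {C E N M : Type w} [Field C]
    [Field E] [Field N] [CommRing M] [Algebra C E] [Algebra C N] [Algebra E N]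
    [IsScalarTower C E N] [FiniteDimensional C N] [FiniteDimensional C E] [IsGalois C N]
    [Algebra E M] (hM : IsGeomIntegral E M) :
    ∃ (F : Type w) (_ : Field F) (_ : Algebra C F),
      IsGeomIntegral C F ∧ Nonempty (M →ₐ[E] E ⊗[C] F) := by
  obtain ⟨n, ⟨e⟩⟩ := Finite.exists_equiv_fin (E →ₐ[C] N)
  obtain ⟨Q, _, _, ι, hι, hlift, hext, hQ⟩ :=
    hM.exists_tensorProduct_baseChange n fun i => (e.symm i : E →+* N)
  have := hQ.isDomain
  -- Composition with `γ` permutes the embeddings `E → N`; `ρ γ` acts as `γ` on `N` and permutes the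
  -- copies of `M` accordingly.
  have hρ : ∀ γ : N ≃ₐ[C] N, ∃ ρ : Q →+* Q,
      ρ.comp (algebraMap N Q) = (algebraMap N Q).comp (γ : N →+* N) ∧
      ∀ i, ρ.comp (ι i) = ι (e ((γ : N →ₐ[C] N).comp (e.symm i))) := by
    intro γ
    refine hlift Q _ _ fun i => ?_
    rw [hι]
    refine RingHom.ext fun x => ?_
    simp
  choose ρ hρN hρι using hρ
  have hone : ρ 1 = RingHom.id Q := by
    refine hext Q _ _ ?_ fun i => ?_
    · rw [hρN]
      exact RingHom.ext fun x => by simp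
    · rw [hρι]
      refine RingHom.ext fun x => ?_
      have : ((1 : N ≃ₐ[C] N) : N →ₐ[C] N).comp (e.symm i) = e.symm i := AlgHom.ext fun x => rfl
      rw [this, Equiv.apply_symm_apply]
      rfl
  have hmul : ∀ γ δ, ρ (γ * δ) = (ρ γ).comp (ρ δ) := by
    intro γ δ
    refine hext Q _ _ ?_ fun i => ?_
    · rw [hρN, RingHom.comp_assoc, hρN, ← RingHom.comp_assoc, hρN]
      exact RingHom.ext fun x => rfl
    · rw [hρι, RingHom.comp_assoc, hρι, hρι, Equiv.symm_apply_apply]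
      rfl
  let : MulSemiringAction (N ≃ₐ[C] N) Q :=
    { smul := fun γ x => ρ γ x
      one_smul := fun x => by change ρ 1 x = x; rw [hone]; rfl
      mul_smul := fun γ δ x => by change ρ (γ * δ) x = ρ γ (ρ δ x); rw [hmul]; rfl
      smul_zero := fun γ => map_zero (ρ γ)
      smul_add := fun γ x y => map_add (ρ γ) x y
      smul_one := fun γ => map_one (ρ γ)
      smul_mul := fun γ x y => map_mul (ρ γ) x y }
  let P := FractionRing Q
  let : MulSemiringAction (N ≃ₐ[C] N) P := IsFractionRing.mulSemiringAction _ Q P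
  have hQP : ∀ (γ : N ≃ₐ[C] N) (x : Q), γ • algebraMap Q P x = algebraMap Q P (ρ γ x) := by
    intro γ x
    exact IsFractionRing.ringEquivOfRingEquiv_algebraMap _ x
  let : Algebra C P := ((algebraMap N P).comp (algebraMap C N)).toAlgebra
  have : IsScalarTower C N P := .of_algebraMap_eq fun _ => rfl
  let : Algebra E P := ((algebraMap N P).comp (algebraMap E N)).toAlgebra
  have : IsScalarTower E N P := .of_algebraMap_eq fun _ => rfl
  have : IsScalarTower C E P := .of_algebraMap_eq fun x => by
    change algebraMap N P (algebraMap C N x) = algebraMap N P (algebraMap E N (algebraMap C E x))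
    rw [← IsScalarTower.algebraMap_apply C E N]
  have hact : ∀ (γ : N ≃ₐ[C] N) n, γ • algebraMap N P n = algebraMap N P (γ n) := by
    intro γ n
    rw [IsScalarTower.algebraMap_apply N Q P, IsScalarTower.algebraMap_apply N Q P, hQP]
    exact congrArg (fun f : N →+* Q => algebraMap Q P (f n)) (hρN γ)
  have : SMulCommClass (N ≃ₐ[C] N) C P := ⟨fun γ c x => by
    rw [Algebra.smul_def, Algebra.smul_def, smul_mul', IsScalarTower.algebraMap_apply C N P,
      hact, AlgEquiv.commutes]⟩
  have hP : IsGeomIntegral N P := hQ.fractionRing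
  let F : IntermediateField C P := FixedPoints.intermediateField (N ≃ₐ[C] N)
  have hF : IsGeomIntegral C F := hP.fixedPoints hact
  have hdom : IsDomain (E ⊗[C] F) := hF E
  let φ : E ⊗[C] F →ₐ[E] P :=
    Algebra.TensorProduct.lift (Algebra.ofId E P) F.val (fun _ _ => Commute.all _ _)
  have hφ : Function.Injective φ := injective_tensorProductLift_of_isDomain F.val hdom
  -- The copy of `M` indexed by the given inclusion is used: an automorphism trivial on `E` fixes
  -- this index, hence this copy pointwise.
  let σ : E →ₐ[C] N := IsScalarTower.toAlgHom C E N
  have hσ : ∀ x, algebraMap Q P (ι (e σ) (algebraMap E M x)) = algebraMap E P x := by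
    intro x
    have := congrArg (fun f : E →+* Q => algebraMap Q P (f x)) (hι (e σ))
    simp only [Equiv.symm_apply_apply] at this
    exact this.trans (IsScalarTower.algebraMap_apply N Q P _).symm
  let f : M →ₐ[E] P := { (algebraMap Q P).comp (ι (e σ)) with commutes' := hσ }
  have hf : ∀ m, f m ∈ φ.range := by
    intro m
    refine mem_range_tensorProductLift_of_mem_adjoin F.val hdom (mem_adjoin_fixedPoints hact ?_)
    intro γ hγ
    have h1 : (γ : N →ₐ[C] N).comp (e.symm (e σ)) = σ := AlgHom.ext fun x => by
      rw [Equiv.symm_apply_apply]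
      exact hγ x
    have h2 := hρι γ (e σ)
    rw [h1] at h2
    exact (hQP γ _).trans (congrArg (fun f : M →+* Q => algebraMap Q P (f m)) h2)
  exact ⟨F, inferInstance, inferInstance, hF,
    ⟨(AlgEquiv.ofInjective φ hφ).symm.toAlgHom.comp (f.codRestrict φ.range hf)⟩⟩

/-- A geometrically integral algebra `M` over a finite separable extension `E / C` has a point in
`E ⊗ F` for some geometrically integral field extension `F / C`. -/
theorem IsGeomIntegral.exists_algHom_tensorProduct_of_isSeparable {C E M : Type w} [Field C]
    [Field E] [CommRing M] [Algebra C E] [FiniteDimensional C E] [Algebra.IsSeparable C E]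
    [Algebra E M] (hM : IsGeomIntegral E M) :
    ∃ (F : Type w) (_ : Field F) (_ : Algebra C F),
      IsGeomIntegral C F ∧ Nonempty (M →ₐ[E] E ⊗[C] F) := by
  let : Algebra E (SeparableClosure C) :=
    (IsSepClosed.lift : E →ₐ[C] SeparableClosure C).toRingHom.toAlgebra
  have : IsScalarTower C E (SeparableClosure C) := .of_algebraMap_eq fun x =>
    ((IsSepClosed.lift : E →ₐ[C] SeparableClosure C).commutes x).symm
  exact hM.exists_algHom_tensorProduct_of_isGalois (N := normalClosure C E (SeparableClosure C))

/-- A finitely generated geometrically integral algebra `A` over a finite extension `K / C` has a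
point in `K ⊗ F` for some geometrically integral field extension `F / C`. -/
theorem IsGeomIntegral.exists_algHom_tensorProduct {C K A : Type w} [Field C] [Field K]
    [CommRing A] [Algebra C K] [FiniteDimensional C K] [Algebra K A] [Algebra.FiniteType K A]
    (hA : IsGeomIntegral K A) :
    ∃ (F : Type w) (_ : Field F) (_ : Algebra C F),
      IsGeomIntegral C F ∧ Nonempty (A →ₐ[K] K ⊗[C] F) := by
  have := hA.isDomain
  -- `K / E` is purely inseparable and `E / C` is separable, so the two descents apply in turn.
  let E := separableClosure C K
  let L := FractionRing A
  have hL : IsGeomIntegral K L := hA.fractionRing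
  have : Algebra.EssFiniteType K L := Algebra.EssFiniteType.comp K A L
  obtain ⟨M, _, _, ⟨ψ⟩⟩ := hL.exists_descent (E := E)
  obtain ⟨F, _, _, hF, ⟨g⟩⟩ :=
    (hL.of_bijective ψ).exists_algHom_tensorProduct_of_isSeparable (C := C)
  refine ⟨F, inferInstance, inferInstance, hF, ⟨?_⟩⟩
  exact ((Algebra.TensorProduct.cancelBaseChange C E K K F).toAlgHom.comp
    ((Algebra.TensorProduct.map (AlgHom.id K K) g).comp ψ.symm.toAlgHom)).comp
      (IsScalarTower.toAlgHom K A L)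

end FiniteDescent

/-! ### The shear map of a Hopf algebra -/

section Shear

variable (k : Type u) (H : Type v) [Field k] [CommRing H] [HopfAlgebra k H]

/-- The algebra endomorphism `g ⊗ h ↦ g S(h₁) ⊗ h₂` of `H ⊗ H`, where `S` is the antipode. -/
noncomputable def HopfAlgebra.shear : H ⊗[k] H →ₐ[k] H ⊗[k] H :=
  Algebra.TensorProduct.lift Algebra.TensorProduct.includeLeft
    ((Algebra.TensorProduct.map (HopfAlgebra.antipodeAlgHom k H) (AlgHom.id k H)).comp
      (Bialgebra.comulAlgHom k H)) (fun _ _ => Commute.all _ _)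

theorem HopfAlgebra.shear_comp_includeLeft :
    (HopfAlgebra.shear k H).comp Algebra.TensorProduct.includeLeft =
      Algebra.TensorProduct.includeLeft :=
  AlgHom.ext fun x => by simp [HopfAlgebra.shear]

/-- In Sweedler notation, `x₁ S(x₂) ⊗ x₃ = ε(x₁) 1 ⊗ x₂ = 1 ⊗ x`, by coassociativity, the antipode
axiom and the counit axiom. -/
theorem HopfAlgebra.shear_comp_comul :
    (HopfAlgebra.shear k H).comp (Bialgebra.comulAlgHom k H) =
      Algebra.TensorProduct.includeRight := by
  -- `G` is `(a ⊗ b) ⊗ c ↦ a S(b) ⊗ c`.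
  let G : (H ⊗[k] H) ⊗[k] H →ₗ[k] H ⊗[k] H :=
    LinearMap.rTensor H (LinearMap.mul' k H ∘ₗ LinearMap.lTensor H (HopfAlgebra.antipode k))
  have h₁ : ∀ z : H ⊗[k] H, HopfAlgebra.shear k H z =
      G ((TensorProduct.assoc k H H H).symm (LinearMap.lTensor H Coalgebra.comul z)) := by
    intro z
    induction z using TensorProduct.induction_on with
    | zero => simp
    | add x y hx hy => rw [map_add, hx, hy, map_add, map_add, map_add]
    | tmul a b =>
      have : ∀ w : H ⊗[k] H, (a ⊗ₜ[k] (1 : H)) *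
          (Algebra.TensorProduct.map (HopfAlgebra.antipodeAlgHom k H) (AlgHom.id k H)) w =
          G ((TensorProduct.assoc k H H H).symm (a ⊗ₜ w)) := by
        intro w
        induction w using TensorProduct.induction_on with
        | zero => simp
        | add x y hx hy => rw [map_add, mul_add, hx, hy, TensorProduct.tmul_add, map_add, map_add]
        | tmul x y =>
          simp only [Algebra.TensorProduct.map_tmul, Algebra.TensorProduct.tmul_mul_tmul, one_mul,
            TensorProduct.assoc_symm_tmul, G, LinearMap.rTensor_tmul, LinearMap.comp_apply,
            LinearMap.lTensor_tmul, LinearMap.mul'_apply]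
          rfl
      rw [LinearMap.lTensor_tmul, ← this]
      simp [HopfAlgebra.shear]
  refine AlgHom.ext fun x => ?_
  change HopfAlgebra.shear k H (Coalgebra.comul x) = 1 ⊗ₜ x
  rw [h₁, Coalgebra.coassoc_symm_apply]
  change (LinearMap.rTensor H _ ∘ₗ LinearMap.rTensor H _) _ = _
  rw [← LinearMap.rTensor_comp, LinearMap.comp_assoc, HopfAlgebra.mul_antipode_lTensor_comul,
    LinearMap.rTensor_comp, LinearMap.comp_apply, Coalgebra.rTensor_counit_comul]
  simp

end Shear

/-! ### Finiteness of a `𝔤`-field over its constants -/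

namespace GroupSchemeAction

section Invariants

variable {k : Type u} {H : Type v} [Field k] [CommRing H] [HopfAlgebra k H]
  {K : Type w} [Field K] [Algebra k K]

/-- The field of constants of a `𝔤`-field. -/
noncomputable def constants (D : GroupSchemeAction k H K) : IntermediateField k K where
  __ := AlgHom.equalizer D.coact Algebra.TensorProduct.includeLeft
  inv_mem' x hx := by
    change D.coact x⁻¹ = x⁻¹ ⊗ₜ 1
    have hx' : D.coact x = x ⊗ₜ 1 := hx
    by_cases h : x = 0
    · simp [h]
    · calc D.coact x⁻¹ = (x⁻¹ ⊗ₜ 1 * D.coact x) * D.coact x⁻¹ := by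
            rw [hx', Algebra.TensorProduct.tmul_mul_tmul, inv_mul_cancel₀ h, one_mul,
              ← Algebra.TensorProduct.one_def, one_mul]
        _ = x⁻¹ ⊗ₜ 1 := by rw [mul_assoc, ← map_mul, mul_inv_cancel₀ h, map_one, mul_one]

theorem mem_constants {D : GroupSchemeAction k H K} {x : K} :
    x ∈ D.constants ↔ D.coact x = x ⊗ₜ 1 := Iff.rfl

/-- The operator on a `𝔤`-field given by a linear functional on `H`. -/
noncomputable def operator (D : GroupSchemeAction k H K) (l : H →ₗ[k] k) : K →ₗ[k] K :=
  (TensorProduct.rid k K).toLinearMap ∘ₗ LinearMap.lTensor K l ∘ₗ D.coact.toLinearMap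

/-- Applying `∂ ⊗ id` to the relation gives one in `K ⊗ H ⊗ H`. There the shear keeps each `∂(a i)`
in the first two factors and, by coassociativity, moves `∂(x i)` to the first and third; `l` is then
applied to the middle factor. -/
theorem sum_operator_mul_coact (D : GroupSchemeAction k H K) {ι : Type*} (s : Finset ι)
    (a x : ι → K) (h : ∑ i ∈ s, (a i ⊗ₜ 1) * D.coact (x i) = 0) (l : H →ₗ[k] k) :
    ∑ i ∈ s, (D.operator l (a i) ⊗ₜ 1) * D.coact (x i) = 0 := by
  let j₁₂ : K ⊗[k] H →ₐ[k] K ⊗[k] (H ⊗[k] H) :=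
    Algebra.TensorProduct.map (AlgHom.id k K) Algebra.TensorProduct.includeLeft
  let j₁₃ : K ⊗[k] H →ₐ[k] K ⊗[k] (H ⊗[k] H) :=
    Algebra.TensorProduct.map (AlgHom.id k K) Algebra.TensorProduct.includeRight
  let Ψ : K ⊗[k] (H ⊗[k] H) →ₐ[k] K ⊗[k] (H ⊗[k] H) :=
    Algebra.TensorProduct.map (AlgHom.id k K) (HopfAlgebra.shear k H)
  let Δ : K ⊗[k] H →ₐ[k] K ⊗[k] (H ⊗[k] H) :=
    (Algebra.TensorProduct.assoc k k k K H H).toAlgHom.comp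
      (Algebra.TensorProduct.map D.coact (AlgHom.id k H))
  have hΨ₁ : ∀ z, Ψ (j₁₂ z) = j₁₂ z := fun z => by
    have : Ψ.comp j₁₂ = j₁₂ := by
      rw [← Algebra.TensorProduct.map_comp, HopfAlgebra.shear_comp_includeLeft, AlgHom.comp_id]
    exact congrArg (fun f : _ →ₐ[k] _ => f z) this
  have hΨ₂ : ∀ y, Ψ (Δ (D.coact y)) = j₁₃ (D.coact y) := fun y => by
    have h1 : Δ (D.coact y) =
        Algebra.TensorProduct.map (AlgHom.id k K) (Bialgebra.comulAlgHom k H) (D.coact y) :=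
      congrArg (fun f : _ →ₐ[k] _ => f y) D.coassoc
    have h2 : Ψ.comp (Algebra.TensorProduct.map (AlgHom.id k K) (Bialgebra.comulAlgHom k H)) =
        j₁₃ := by
      rw [← Algebra.TensorProduct.map_comp, HopfAlgebra.shear_comp_comul, AlgHom.comp_id]
    rw [h1]
    exact congrArg (fun f : _ →ₐ[k] _ => f (D.coact y)) h2
  have hΔ : ∀ y, Δ (y ⊗ₜ 1) = j₁₂ (D.coact y) := fun y => by
    have : ∀ z : K ⊗[k] H, (Algebra.TensorProduct.assoc k k k K H H) (z ⊗ₜ 1) = j₁₂ z := by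
      intro z
      induction z using TensorProduct.induction_on with
      | zero => simp
      | add x y hx hy => rw [TensorProduct.add_tmul, map_add, hx, hy, map_add]
      | tmul x y => simp [j₁₂]
    simp only [Δ, AlgHom.comp_apply, Algebra.TensorProduct.map_tmul, map_one]
    exact this _
  have hsum : ∑ i ∈ s, j₁₂ (D.coact (a i)) * j₁₃ (D.coact (x i)) = 0 := by
    have := congrArg (fun z => Ψ (Δ z)) h
    simp only [map_sum, map_mul, map_zero, hΔ, hΨ₁, hΨ₂] at this
    exact this
  let Λ : K ⊗[k] (H ⊗[k] H) →ₗ[k] K ⊗[k] H :=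
    LinearMap.lTensor K ((TensorProduct.lid k H).toLinearMap ∘ₗ LinearMap.rTensor H l)
  have hΛ : ∀ z w : K ⊗[k] H, Λ (j₁₂ z * j₁₃ w) =
      ((TensorProduct.rid k K (LinearMap.lTensor K l z)) ⊗ₜ 1) * w := by
    intro z w
    induction z using TensorProduct.induction_on with
    | zero => simp
    | add x y hx hy =>
      rw [map_add, add_mul, map_add, hx, hy, map_add, map_add, TensorProduct.add_tmul, add_mul]
    | tmul x g =>
      induction w using TensorProduct.induction_on with
      | zero => simp
      | add x y hx hy => rw [map_add, mul_add, map_add, hx, hy, mul_add]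
      | tmul y h =>
        simp [j₁₂, j₁₃, Λ, TensorProduct.smul_tmul']
  have := congrArg Λ hsum
  rw [map_sum, map_zero] at this
  rw [← this]
  exact Finset.sum_congr rfl fun i _ => (hΛ _ _).symm

theorem operator_one (D : GroupSchemeAction k H K) (l : H →ₗ[k] k) :
    D.operator l 1 = algebraMap k K (l 1) := by
  simp [operator, Algebra.TensorProduct.one_def, Algebra.algebraMap_eq_smul_one]

/-- The coordinate functionals of a basis of `H` determine `∂ x`, and `x ⊗ 1` has coordinates `l(1)
x`. -/
theorem mem_constants_of_operator {D : GroupSchemeAction k H K} {x : K}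
    (h : ∀ l, D.operator l x = algebraMap k K (l 1) * x) : x ∈ D.constants := by
  rw [mem_constants]
  let b := Module.Basis.ofVectorSpace k H
  refine (b.baseChange K).ext_elem fun i => ?_
  have key : ∀ z : K ⊗[k] H, (b.baseChange K).repr z i =
      TensorProduct.rid k K (LinearMap.lTensor K (b.coord i) z) := by
    intro z
    induction z using TensorProduct.induction_on with
    | zero => simp
    | add x y hx hy => simp [hx, hy]
    | tmul x y => simp [Algebra.smul_def, mul_comm]
  rw [key, key]
  refine (h (b.coord i)).trans ?_
  simp [Algebra.smul_def]

theorem coact_counit (D : GroupSchemeAction k H K) (x : K) :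
    Algebra.TensorProduct.rid k K K (Algebra.TensorProduct.map (AlgHom.id K K)
      (Bialgebra.counitAlgHom k H) (D.coact x)) = x := by
  have key : ∀ z : K ⊗[k] H, Algebra.TensorProduct.rid k K K (Algebra.TensorProduct.map
      (AlgHom.id K K) (Bialgebra.counitAlgHom k H) z) =
      Algebra.TensorProduct.rid k k K (Algebra.TensorProduct.map
        (AlgHom.id k K) (Bialgebra.counitAlgHom k H) z) := by
    intro z
    induction z using TensorProduct.induction_on with
    | zero => simp
    | add x y hx hy => simp only [map_add, hx, hy]
    | tmul x y => simp
  rw [key]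
  exact congrArg (fun f : K →ₐ[k] K => f x) D.counit_coact

/-- Elements of a `𝔤`-field which are linearly independent over the constants have coactions which
are linearly independent over the field. -/
theorem linearIndependent_coact (D : GroupSchemeAction k H K) {ι : Type*} {x : ι → K}
    (hx : LinearIndependent D.constants x) : LinearIndependent K fun i => D.coact (x i) := by
  classical
  rw [linearIndependent_iff']
  intro s
  induction s using Finset.induction_on with
  | empty => simp
  | insert j s hj ih =>
    intro a ha
    have hred : a j = 0 → ∀ i ∈ insert j s, a i = 0 := by
      intro h0 i hi
      rcases Finset.mem_insert.1 hi with rfl | hi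
      · exact h0
      · refine ih a ?_ i hi
        rwa [Finset.sum_insert hj, h0, zero_smul, zero_add] at ha
    refine hred ?_
    by_contra hne
    -- As in Artin's lemma, the relation is normalised to have coefficient `1` at `j`.
    let c : ι → K := fun i => (a j)⁻¹ * a i
    have hcj : c j = 1 := inv_mul_cancel₀ hne
    have hc : ∑ i ∈ insert j s, (c i ⊗ₜ 1) * D.coact (x i) = 0 := by
      have := congrArg (fun z => (a j)⁻¹ • z) ha
      simp only [smul_zero, Finset.smul_sum, smul_smul] at this
      rw [← this]
      exact Finset.sum_congr rfl fun i _ => (Algebra.smul_def (c i) (D.coact (x i))).symm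
    have hconst : ∀ i ∈ insert j s, c i ∈ D.constants := by
      intro i hi
      refine mem_constants_of_operator fun l => ?_
      have h1 := D.sum_operator_mul_coact _ c x hc l
      -- Subtracting `l(1)` times the relation kills the term at `j`, because the operator of `l`
      -- sends `1` to `l(1)`; by induction all the other differences vanish, so every `c i` is
      -- constant.
      have h2 : ∑ i ∈ insert j s,
          (D.operator l (c i) - algebraMap k K (l 1) * c i) • D.coact (x i) = 0 := by
        have h3 : ∀ i ∈ insert j s,
            (D.operator l (c i) - algebraMap k K (l 1) * c i) • D.coact (x i) =
            (D.operator l (c i) ⊗ₜ 1) * D.coact (x i) -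
              algebraMap k K (l 1) • ((c i ⊗ₜ 1) * D.coact (x i)) := by
          intro i _
          rw [sub_smul, mul_smul, Algebra.smul_def, Algebra.smul_def (c i)]
          rfl
        rw [Finset.sum_congr rfl h3, Finset.sum_sub_distrib, h1, ← Finset.smul_sum, hc,
          smul_zero, sub_zero]
      have hj0 : D.operator l (c j) - algebraMap k K (l 1) * c j = 0 := by
        rw [hcj, operator_one, mul_one, sub_self]
      rw [Finset.sum_insert hj, hj0, zero_smul, zero_add] at h2
      rcases Finset.mem_insert.1 hi with rfl | hi
      · exact sub_eq_zero.1 hj0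
      · exact sub_eq_zero.1 (ih _ h2 i hi)
    -- The counit turns the relation between coactions into one between the `x i`, now with constant
    -- coefficients.
    have hzero : ∑ i ∈ insert j s, c i * x i = 0 := by
      have := congrArg (fun z => Algebra.TensorProduct.rid k K K (Algebra.TensorProduct.map
        (AlgHom.id K K) (Bialgebra.counitAlgHom k H) z)) hc
      simp only [map_sum, map_mul, map_zero, coact_counit] at this
      simpa using this
    rw [linearIndependent_iff'] at hx
    have := hx (insert j s) (fun i => if h : i ∈ insert j s then ⟨c i, hconst i h⟩ else 0)
      (by
        rw [← hzero]
        refine Finset.sum_congr rfl fun i hi => ?_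
        rw [dif_pos hi]
        rfl) j (Finset.mem_insert_self j s)
    rw [dif_pos (Finset.mem_insert_self j s)] at this
    have h1 : c j = 0 := congrArg Subtype.val this
    rw [hcj] at h1
    exact one_ne_zero h1

/-- A `𝔤`-field is a finite extension of its field of constants. -/
theorem finiteDimensional_constants (D : GroupSchemeAction k H K) [Module.Finite k H] :
    FiniteDimensional D.constants K := by
  let b := Module.Basis.ofVectorSpace D.constants K
  have := D.linearIndependent_coact b.linearIndependent
  have : Finite (Module.Basis.ofVectorSpaceIndex D.constants K) := this.finite
  exact Module.Finite.of_basis b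

end Invariants

end GroupSchemeAction

/-! ### Extension of the action to `K ⊗ F`, trivially on `F` -/

/-- The axioms of an action compare maps that are only `k`-linear, on a tensor product over `C`. -/
theorem Algebra.TensorProduct.algHom_ext_of_tmul {k C K F S : Type*} [CommSemiring k]
    [CommSemiring C] [CommSemiring K] [CommSemiring F] [Semiring S] [Algebra k C] [Algebra C K]
    [Algebra C F] [Algebra k K] [IsScalarTower k C K] [Algebra k S] {f g : K ⊗[C] F →ₐ[k] S} (h₁ : ∀ x, f (x ⊗ₜ 1) = g (x ⊗ₜ 1))
    (h₂ : ∀ y, f (1 ⊗ₜ y) = g (1 ⊗ₜ y)) : f = g := by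
  refine AlgHom.ext fun z => ?_
  induction z using TensorProduct.induction_on with
  | zero => simp
  | add x y hx hy => rw [map_add, map_add, hx, hy]
  | tmul x y =>
    have : x ⊗ₜ[C] y = (x ⊗ₜ 1) * (1 ⊗ₜ y) := by simp
    rw [this, map_mul, map_mul, h₁, h₂]

namespace GroupSchemeAction

section BaseChange

variable {k : Type u} {H : Type v} [Field k] [CommRing H] [HopfAlgebra k H]
  {K C : Type w} [Field K] [Algebra k K] [Field C] [Algebra k C] [Algebra C K]
  [IsScalarTower k C K] (D : GroupSchemeAction k H K)
  (hC : ∀ c, D.coact (algebraMap C K c) = algebraMap C K c ⊗ₜ 1)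
  (F : Type w) [Field F] [Algebra C F]

/-- The coaction on `K ⊗ F`, where `F` is an extension of a subfield `C` of constants of `K`,
which extends the one on `K` and is trivial on `F`. -/
noncomputable def baseChangeCoact :
    K ⊗[C] F →ₐ[C] (K ⊗[C] F) ⊗[k] H :=
  Algebra.TensorProduct.lift
    { ((Algebra.TensorProduct.map
        (Algebra.TensorProduct.includeLeft : K →ₐ[k] K ⊗[C] F)
        (AlgHom.id k H)).comp D.coact).toRingHom with
      commutes' := fun c => by
        change Algebra.TensorProduct.map _ _ (D.coact (algebraMap C K c)) = _
        rw [hC]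
        rfl }
    ((Algebra.TensorProduct.includeLeft :
      K ⊗[C] F →ₐ[C] (K ⊗[C] F) ⊗[k] H).comp
        Algebra.TensorProduct.includeRight)
    (fun _ _ => Commute.all _ _)

theorem baseChangeCoact_tmul_one (x : K) : D.baseChangeCoact hC F (x ⊗ₜ 1) =
    Algebra.TensorProduct.map (Algebra.TensorProduct.includeLeft : K →ₐ[k] K ⊗[C] F)
      (AlgHom.id k H) (D.coact x) := by
  simp only [baseChangeCoact, Algebra.TensorProduct.lift_tmul, map_one, mul_one]
  rfl

theorem baseChangeCoact_one_tmul (y : F) :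
    D.baseChangeCoact hC F (1 ⊗ₜ y) = (1 ⊗ₜ y) ⊗ₜ 1 := by
  simp [baseChangeCoact]

/-- The action of a finite group scheme on `K ⊗ F`, where `F` is an extension of a subfield
`C` of constants of `K` on which it acts trivially. -/
noncomputable def baseChange : GroupSchemeAction k H (K ⊗[C] F) where
  coact := (D.baseChangeCoact hC F).restrictScalars k
  counit_coact := by
    let j : K →ₐ[k] K ⊗[C] F := Algebra.TensorProduct.includeLeft
    -- On `x ⊗ 1` the axiom is the image under `j` of the one for `D`; on `1 ⊗ y` the coaction is
    -- trivial.
    refine Algebra.TensorProduct.algHom_ext_of_tmul (fun x => ?_) fun y => ?_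
    · have h1 : ((Algebra.TensorProduct.rid k k (K ⊗[C] F)).toAlgHom.comp
          (Algebra.TensorProduct.map (AlgHom.id k _) (Bialgebra.counitAlgHom k H))).comp
          (Algebra.TensorProduct.map j (AlgHom.id k H)) =
          j.comp ((Algebra.TensorProduct.rid k k K).toAlgHom.comp
            (Algebra.TensorProduct.map (AlgHom.id k K) (Bialgebra.counitAlgHom k H))) := by
        ext <;> simp
      have h2 := congrArg (fun f : _ →ₐ[k] _ => f (D.coact x)) h1
      have h3 := congrArg (fun f : K →ₐ[k] K => j (f x)) D.counit_coact
      rw [AlgHom.comp_apply, AlgHom.restrictScalars_apply, baseChangeCoact_tmul_one]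
      exact h2.trans h3
    · rw [AlgHom.comp_apply, AlgHom.restrictScalars_apply, baseChangeCoact_one_tmul]
      simp
  coassoc := by
    let j : K →ₐ[k] K ⊗[C] F := Algebra.TensorProduct.includeLeft
    let d := (D.baseChangeCoact hC F).restrictScalars k
    refine Algebra.TensorProduct.algHom_ext_of_tmul (fun x => ?_) fun y => ?_
    · have h0 : d.comp j = (Algebra.TensorProduct.map j (AlgHom.id k H)).comp D.coact :=
        AlgHom.ext fun x => D.baseChangeCoact_tmul_one hC F x
      have h1 : ((Algebra.TensorProduct.assoc k k k (K ⊗[C] F) H H).toAlgHom.comp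
          (Algebra.TensorProduct.map d (AlgHom.id k H))).comp
          (Algebra.TensorProduct.map j (AlgHom.id k H)) =
          (Algebra.TensorProduct.map j (AlgHom.id k (H ⊗[k] H))).comp
            ((Algebra.TensorProduct.assoc k k k K H H).toAlgHom.comp
              (Algebra.TensorProduct.map D.coact (AlgHom.id k H))) := by
        rw [AlgHom.comp_assoc, ← Algebra.TensorProduct.map_comp, h0, AlgHom.comp_id,
          ← AlgHom.comp_id (AlgHom.id k H), Algebra.TensorProduct.map_comp,
          ← AlgHom.comp_assoc, ← AlgHom.comp_assoc]
        congr 1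
        ext <;> simp [Algebra.TensorProduct.one_def]
      have h2 : (Algebra.TensorProduct.map (AlgHom.id k (K ⊗[C] F))
          (Bialgebra.comulAlgHom k H)).comp (Algebra.TensorProduct.map j (AlgHom.id k H)) =
          (Algebra.TensorProduct.map j (AlgHom.id k (H ⊗[k] H))).comp
            (Algebra.TensorProduct.map (AlgHom.id k K) (Bialgebra.comulAlgHom k H)) := by
        rw [← Algebra.TensorProduct.map_comp, ← Algebra.TensorProduct.map_comp]
        rfl
      have h3 := congrArg (fun f : _ →ₐ[k] _ => f (D.coact x)) h1
      have h4 := congrArg (fun f : _ →ₐ[k] _ => f (D.coact x)) h2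
      have h5 := congrArg (fun f : K →ₐ[k] _ =>
        Algebra.TensorProduct.map j (AlgHom.id k (H ⊗[k] H)) (f x)) D.coassoc
      rw [AlgHom.comp_apply, AlgHom.comp_apply (φ₂ := d), AlgHom.restrictScalars_apply,
        baseChangeCoact_tmul_one]
      exact h3.trans (h5.trans h4.symm)
    · rw [AlgHom.comp_apply, AlgHom.comp_apply (φ₂ := d), AlgHom.restrictScalars_apply,
        baseChangeCoact_one_tmul]
      simp [baseChangeCoact_one_tmul, Algebra.TensorProduct.one_def]

theorem isHom_baseChange :
    D.IsHom (D.baseChange hC F)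
      (Algebra.TensorProduct.includeLeft : K →ₐ[k] K ⊗[C] F) :=
  AlgHom.ext fun x => D.baseChangeCoact_tmul_one hC F x

end BaseChange

end GroupSchemeAction

/-! ### Polynomial systems as quantifier-free formulas -/

namespace GroupSchemeAction

section Language

variable {k : Type u} {H : Type v} [Field k] [CommRing H] [HopfAlgebra k H]

open FirstOrder in
/-- A polynomial over `A` as a term of the language of `𝔤`-rings with parameters from `A`. -/
theorem exists_term_realize_eq_eval₂ (m : ℕ) {A : Type w} [CommRing A] {n : ℕ}
    (p : MvPolynomial (Fin n) A) : ∃ t : (Lang k m).Term (A ⊕ Fin n),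
      ∀ (R : Type w) [CommRing R] [Algebra k R] (D : GroupSchemeAction k H R)
        (b : Module.Basis (Fin (m + 1)) k H) (f : A →+* R) (a : Fin n → R),
        letI := D.langStructure b
        t.realize (Sum.elim f a) = MvPolynomial.eval₂ f a p := by
  induction p using MvPolynomial.induction_on with
  | C c => exact ⟨Language.var (.inl c), fun R _ _ D b f a => by simp⟩
  | add p q hp hq =>
    obtain ⟨s, hs⟩ := hp
    obtain ⟨t, ht⟩ := hq
    refine ⟨Language.Term.func (l := 2)
      (Language.LHom.sumInl.onFunction Ring.addFunc : (Lang k m).Functions 2) ![s, t],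
      fun R _ _ D b f a => ?_⟩
    rw [MvPolynomial.eval₂_add, ← hs R D b f a, ← ht R D b f a]
    rfl
  | mul_X p i hp =>
    obtain ⟨s, hs⟩ := hp
    refine ⟨Language.Term.func (l := 2)
      (Language.LHom.sumInl.onFunction Ring.mulFunc : (Lang k m).Functions 2) ![s, Language.var (.inr i)],
      fun R _ _ D b f a => ?_⟩
    rw [MvPolynomial.eval₂_mul, MvPolynomial.eval₂_X, ← hs R D b f a]
    rfl

open FirstOrder in
/-- A finite system of polynomial equations over `A` is a quantifier-free formula of the language
of `𝔤`-rings with parameters from `A`. -/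
theorem exists_isQF_holds_iff (m : ℕ) {A : Type w} [CommRing A] {n : ℕ}
    (s : Finset (MvPolynomial (Fin n) A)) : ∃ φ : (Lang k m).Formula (A ⊕ Fin n), φ.IsQF ∧
      ∀ (R : Type w) [CommRing R] [Algebra k R] (D : GroupSchemeAction k H R)
        (b : Module.Basis (Fin (m + 1)) k H) (f : A →+* R) (a : Fin n → R),
        D.Holds b φ f a ↔ ∀ p ∈ s, MvPolynomial.eval₂ f a p = 0 := by
  classical
  induction s using Finset.induction_on with
  | empty =>
    refine ⟨⊤, Language.BoundedFormula.IsQF.top, fun R _ _ D b f a => ?_⟩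
    simp [Holds]
  | insert p s _ ih =>
    obtain ⟨φ, hφ, hφ'⟩ := ih
    obtain ⟨t, ht⟩ := exists_term_realize_eq_eval₂ (k := k) (H := H) m p
    obtain ⟨z, hz⟩ := exists_term_realize_eq_eval₂ (k := k) (H := H) m
      (0 : MvPolynomial (Fin n) A)
    refine ⟨(t.equal z) ⊓ φ, ?_, fun R _ _ D b f a => ?_⟩
    · exact (Language.BoundedFormula.IsAtomic.isQF (.equal _ _)).inf hφ
    · have h := hφ' R D b f a
      let := D.langStructure b
      change ((t.equal z) ⊓ φ).Realize (Sum.elim f a) ↔ _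
      change φ.Realize (Sum.elim f a) ↔ _ at h
      rw [Language.Formula.realize_inf, h, Language.Formula.realize_equal, ht R D b f a,
        hz R D b f a, MvPolynomial.eval₂_zero, Finset.forall_mem_insert]

/-- An ideal of polynomials over an existentially closed `𝔤`-field `K` which has a zero in some
`𝔤`-field extension of `K` has a zero in `K`. -/
theorem IsExistentiallyClosed.exists_eval_eq_zero {K : Type w} [Field K] [Algebra k K]
    {D : GroupSchemeAction k H K} {m : ℕ} {b : Module.Basis (Fin (m + 1)) k H}
    (hD : D.IsExistentiallyClosed b) {L : Type w} [CommRing L] [Algebra k L] (hL : IsField L)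
    (E : GroupSchemeAction k H L) (f : K →ₐ[k] L) (hf : D.IsHom E f) {n : ℕ}
    (I : Ideal (MvPolynomial (Fin n) K)) (x : Fin n → L)
    (hx : ∀ p ∈ I, MvPolynomial.eval₂ (f : K →+* L) x p = 0) :
    ∃ a : Fin n → K, ∀ p ∈ I, MvPolynomial.eval a p = 0 := by
  -- By Hilbert's basis theorem, finitely many equations, hence a single formula, express vanishing
  -- of the whole ideal.
  obtain ⟨s, rfl⟩ := (isNoetherianRing_iff_ideal_fg _).1 inferInstance I
  obtain ⟨φ, hφ, hφ'⟩ := exists_isQF_holds_iff (k := k) (H := H) m s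
  let : Field L := hL.toField
  obtain ⟨a, ha⟩ := hD L E f hf n φ hφ ⟨x, (hφ' L E b (f : K →+* L) x).2 fun p hp =>
    hx p (Ideal.subset_span hp)⟩
  have ha' := (hφ' K D b (RingHom.id K) a).1 ha
  refine ⟨a, fun p hp => ?_⟩
  have hle : Ideal.span (s : Set (MvPolynomial (Fin n) K)) ≤ RingHom.ker (MvPolynomial.eval a) :=
    Ideal.span_le.2 fun q hq => by
      rw [SetLike.mem_coe, RingHom.mem_ker, ← MvPolynomial.eval₂_id]
      exact ha' q hq
  exact hle hp

end Language

end GroupSchemeAction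

/-! ### Existentially closed `𝔤`-fields are PAC -/

/-- The coordinate ring of an absolutely irreducible variety is geometrically integral. -/
theorem IsAbsolutelyIrreducible.isGeomIntegral {M : Type w} [Field M] {n : ℕ}
    {I : Ideal (MvPolynomial (Fin n) M)} (hI : IsAbsolutelyIrreducible I) :
    IsGeomIntegral M (MvPolynomial (Fin n) M ⧸ I) := by
  let Ω := AlgebraicClosure M
  refine .of_isDomain (Ω := Ω) ?_
  have : (I.map (MvPolynomial.map (algebraMap M Ω))).IsPrime := hI
  let e := MvPolynomial.algebraTensorAlgEquiv (σ := Fin n) M Ω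
  -- This identifies `Ω ⊗ (M[X] / I)` with `Ω[X] / I Ω[X]`.
  have h : I.map (MvPolynomial.map (algebraMap M Ω)) =
      (I.map (Algebra.TensorProduct.includeRight (R := M) (A := Ω))).map (e : _ →+* _) := by
    refine .trans ?_ (I.map_map (Algebra.TensorProduct.includeRight (R := M) (A := Ω)).toRingHom
      (e : Ω ⊗[M] MvPolynomial (Fin n) M →+* MvPolynomial (Fin n) Ω)).symm
    congr 1
    exact RingHom.ext fun p => by simp [e]
  exact ((Algebra.TensorProduct.tensorQuotientEquiv (R := M) Ω _ Ω I).trans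
    (Ideal.quotientEquivAlg _ _ e h)).toMulEquiv.isDomain

/-- Let `k` be a field, and let `𝔤 = Spec H` be a finite group scheme over `k`, with a basis
`b₀, …, bₘ` of `H` such that `π(b₀) = 1` and `π(bᵢ) = 0` for `i > 0` (used to write `𝔤`-fields as
first-order structures). Every existentially closed `𝔤`-field is pseudo-algebraically closed. -/
theorem corollary4p7 {k : Type u} {H : Type v} {K : Type w} [Field k] [CommRing H]
    [HopfAlgebra k H] {m : ℕ} (b : Module.Basis (Fin (m + 1)) k H)
    (hb₀ : Coalgebra.counit (R := k) (b 0) = 1)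
    (hb : ∀ i : Fin m, Coalgebra.counit (R := k) (b i.succ) = 0)
    [Field K] [Algebra k K] (D : GroupSchemeAction k H K)
    (hD : D.IsExistentiallyClosed b) :
    IsPAC K := by
  intro n I hI
  have : Module.Finite k H := .of_basis b
  have := D.finiteDimensional_constants
  obtain ⟨F, _, _, hF, ⟨g⟩⟩ := hI.isGeomIntegral.exists_algHom_tensorProduct (C := D.constants)
  have := hF K
  -- The images under `g` of the coordinate functions form a point of the variety in the `𝔤`-field
  -- `K ⊗ F`.
  refine hD.exists_eval_eq_zero (Algebra.TensorProduct.isField_of_isAlgebraic D.constants K F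
    (.inl inferInstance)) (D.baseChange (C := D.constants) (fun c => c.2) F)
    Algebra.TensorProduct.includeLeft (D.isHom_baseChange (fun c => c.2) F) I
    (fun i => g (Ideal.Quotient.mk I (.X i))) fun p hp => ?_
  have h : g (Ideal.Quotient.mk I p) = 0 := by
    rw [Ideal.Quotient.eq_zero_iff_mem.2 hp, map_zero]
  rw [← h]
  have : (MvPolynomial.aeval fun i => g (Ideal.Quotient.mk I (.X i))) =
      g.comp (Ideal.Quotient.mkₐ K I) := MvPolynomial.algHom_ext fun i => by simp
  exact congrArg (fun f : _ →ₐ[K] _ => f p) this
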